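/- For an integer $k$ and an integer $m\ge 0$, let $\rho_k^{S_m}(g):=|\{x\in S_m : x^k=g\}|$ $(g\in S_m)$ be the $k$-th root enumerator of the symmetric group $S_m$. Let the odd root enumerator of $S_m$ be $$\rho_{odd}^{S_m}:=\rho_k^{S_m},\qquad k=\operatorname{lcm}\{2i-1 : 1\le i\le (m+1)/2\}$$ (any other odd multiple of all the odd positive integers not exceeding $m$ gives the same function). Then, for every positive integer $n$, $$\rho_{odd}^{S_{2n+1}}=\rho_{odd}^{S_{2n}}\uparrow_{S_{2n}}^{S_{2n+1}},$$ where $S_{2n}\subset S_{2n+1}$ is the subgroup of the permutations that fix the point $2n+1$, and, for a subgroup $H$ of a finite group $G$ and a class function $\chi$ of $H$, the induced class function is $$(\chi\uparrow_H^G)(g)=\frac1{|H|}\sum_{\substack{a\in G\\ a^{-1}ga\in H}}\chi(a^{-1}ga)\qquad(g\in G).$$ -/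

import Mathlib

/-- The `k`-th root enumerator of the symmetric group `S_n`:
the number of `x` in `S_n` with `x ^ k = g`. -/
def rootEnumerator (k : ℤ) (n : ℕ) (g : Equiv.Perm (Fin n)) : ℕ :=
  (Finset.univ.filter fun x : Equiv.Perm (Fin n) => x ^ k = g).card

/-- The least common multiple of the odd numbers `2 * i - 1`, `1 ≤ i ≤ (n + 1) / 2`,
that is, of all the odd positive integers that are at most `n`. -/
def oddLcm (n : ℕ) : ℕ :=
  (Finset.Icc 1 ((n + 1) / 2)).lcm fun i => 2 * i - 1

/-- The odd root enumerator of `S_n`: the `k`-th root enumerator, for `k` an odd multiple of all the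
odd positive integers that are at most `n`. By `rootEnumerator_eq_oddRootEnumerator` below, every
such `k` gives the same function. -/
def oddRootEnumerator (n : ℕ) (g : Equiv.Perm (Fin n)) : ℕ :=
  rootEnumerator (oddLcm n : ℤ) n g

theorem odd_oddLcm (n : ℕ) : Odd (oddLcm n) := by
  have h : oddLcm n ∣ ∏ i ∈ Finset.Icc 1 ((n + 1) / 2), (2 * i - 1) :=
    Finset.lcm_dvd fun i hi => Finset.dvd_prod_of_mem (fun i => 2 * i - 1) hi
  refine Odd.of_dvd_nat (Finset.prod_induction _ Odd (fun _ _ => Odd.mul) odd_one ?_) h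
  intro i hi
  have := (Finset.mem_Icc.1 hi).1
  exact ⟨i - 1, by omega⟩

theorem dvd_oddLcm {n j : ℕ} (hj : Odd j) (hn : j ≤ n) : j ∣ oddLcm n := by
  obtain ⟨m, rfl⟩ := hj
  have := Finset.dvd_lcm (f := fun i => 2 * i - 1)
    (s := Finset.Icc 1 ((n + 1) / 2)) (b := m + 1) (by simp; omega)
  simpa [oddLcm, show 2 * (m + 1) - 1 = 2 * m + 1 by omega] using this

theorem orderOf_dvd_oddLcm {n : ℕ} (x : Equiv.Perm (Fin n)) :
    orderOf x ∣ 2 ^ n * oddLcm n := by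
  rw [← Equiv.Perm.lcm_cycleType, Multiset.lcm_dvd]
  intro c hc
  have hc2 := Equiv.Perm.two_le_of_mem_cycleType hc
  have hcn : c ≤ n := by
    have h1 := Multiset.le_sum_of_mem hc
    rw [Equiv.Perm.sum_cycleType] at h1
    have h3 := Finset.card_le_univ x.support
    simp at h3
    omega
  obtain ⟨a, o, ho, rfl⟩ := Nat.exists_eq_two_pow_mul_odd (n := c) (by omega)
  have ho1 : 0 < o := ho.pos
  have h2a : 0 < 2 ^ a := by positivity
  refine mul_dvd_mul (pow_dvd_pow 2 ?_) (dvd_oddLcm ho ?_)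
  · have : a < 2 ^ a := Nat.lt_two_pow_self
    nlinarith
  · nlinarith

/-- The odd root enumerator does not depend on the choice of the exponent. -/
theorem rootEnumerator_eq_oddRootEnumerator {n : ℕ} {k : ℤ} (hk : Odd k)
    (hd : (oddLcm n : ℤ) ∣ k) (g : Equiv.Perm (Fin n)) :
    rootEnumerator k n g = oddRootEnumerator n g := by
  set L : ℤ := (oddLcm n : ℤ) with hL
  have hLo : Odd L := by rw [hL]; exact_mod_cast odd_oddLcm n
  have cop : ∀ z : ℤ, Odd z → IsCoprime z ((2 : ℤ) ^ n) := fun z hz =>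
    IsCoprime.pow_right (by
      obtain ⟨m, rfl⟩ := hz
      exact ⟨1, -m, by ring⟩)
  obtain ⟨a, b, hab⟩ := cop L hLo
  obtain ⟨e, he⟩ := hd
  -- `c` is `1` modulo `L` and `k / L` modulo `2 ^ n`
  set c : ℤ := b * 2 ^ n + e * (a * L) with hc
  have heo : Odd e := by
    rw [he] at hk
    exact (Int.odd_mul.1 hk).2
  have hcL : IsCoprime c L := by
    refine ⟨1, a - e * a, ?_⟩
    rw [hc]; linear_combination hab
  have hc2 : IsCoprime c ((2 : ℤ) ^ n) := by
    obtain ⟨u, v, huv⟩ := cop e heo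
    refine ⟨u, v - u * b + u * e * b, ?_⟩
    rw [hc]; linear_combination huv + u * e * hab
  obtain ⟨d, f, hdf⟩ := hc2.mul_right hcL
  have key : ∀ (x : Equiv.Perm (Fin n)) (z : ℤ), x ^ (2 ^ n * L * z) = 1 := by
    intro x z
    rw [zpow_mul]
    have := orderOf_dvd_iff_pow_eq_one.1 (orderOf_dvd_oddLcm x)
    have h2 : x ^ ((2 : ℤ) ^ n * L) = 1 := by
      rw [hL, ← this, ← zpow_natCast]; push_cast; rfl
    rw [h2, one_zpow]
  have hcd : ∀ x : Equiv.Perm (Fin n), x ^ (c * d) = x := by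
    intro x
    have : c * d = 1 + 2 ^ n * L * (-f) := by linear_combination hdf
    rw [this, zpow_add, key]; simp
  have hck : ∀ x : Equiv.Perm (Fin n), x ^ (c * L) = x ^ k := by
    intro x
    have : c * L = k + 2 ^ n * L * (b - e * b) := by
      rw [he, hc]; linear_combination e * L * hab
    rw [this, zpow_add, key]; simp
  unfold oddRootEnumerator rootEnumerator
  refine Finset.card_bij' (fun x _ => x ^ c) (fun x _ => x ^ d) ?_ ?_ ?_ ?_
  · intro x hx
    simp only [Finset.mem_filter, Finset.mem_univ, true_and] at hx ⊢
    rw [← zpow_mul, hck, hx]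
  · intro x hx
    simp only [Finset.mem_filter, Finset.mem_univ, true_and] at hx ⊢
    rw [← hck, ← zpow_mul, ← mul_assoc, mul_comm d c, zpow_mul, hcd, hx]
  · intro x _
    simp only [← zpow_mul, hcd]
  · intro x _
    simp only [← zpow_mul, mul_comm d c, hcd]

/-- The class function of `G` induced from a class function `χ` of `H`, where the finite group `H`
is regarded as a subgroup of the finite group `G` through an embedding `φ`:
`g ↦ (1 / |H|) * ∑ a : G, χ⁰ (a⁻¹ * g * a)`,
where `χ⁰` is the extension of `χ` by zero from `H` to `G` (for an injective `φ` the inner sum has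
at most one term, and it is `χ⁰ (a⁻¹ * g * a)`). If `χ` is the character of a representation, then
this is the character of the induced representation. -/
noncomputable def inducedClassFunction {H G : Type*} [Group H] [Fintype H] [Group G] [Fintype G]
    [DecidableEq G] (φ : H →* G) (χ : H → ℂ) (g : G) : ℂ :=
  (Fintype.card H : ℂ)⁻¹ * ∑ a : G, ∑ h : H, if φ h = a⁻¹ * g * a then χ h else 0

/-- The standard embedding of `S_n` into `S_{n+1}`, as the permutations that fix the last point. -/
noncomputable def symmEmbedding (n : ℕ) : Equiv.Perm (Fin n) →* Equiv.Perm (Fin (n + 1)) :=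
  Equiv.Perm.viaEmbeddingHom Fin.castSuccEmb

theorem symmEmbedding_last (n : ℕ) (h : Equiv.Perm (Fin n)) :
    symmEmbedding n h (Fin.last n) = Fin.last n :=
  Equiv.Perm.viaEmbedding_apply_of_notMem _ _ _ (by simp)

theorem symmEmbedding_castSucc (n : ℕ) (h : Equiv.Perm (Fin n)) (i : Fin n) :
    symmEmbedding n h i.castSucc = (h i).castSucc :=
  Equiv.Perm.viaEmbedding_apply h Fin.castSuccEmb i

/-! Inducing a root enumerator counts the roots `x` of `g` in the larger group, each weighted by its
number of fixed points. So the claim is that in odd degree the odd roots of `g` have one fixed point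
on average (`sum_card_fixed_zpow_oddLcm_eq`). A root commutes with `g`, hence splits into an
odd-order permutation of the fixed set of `g` and a root on the moved points; only the first factor
can fix points. If a root exists, `g` has 2-power order, so its fixed set is odd. It remains to
average over odd-order permutations of an odd set, which amounts to c(2m+1) = (2m+1) c(2m) for their
number c. This follows from the recurrence `oddOrderCount_add_two`, obtained by deleting two
consecutive points of a cycle. -/

open Equiv Finset

/-! ### Permutations of odd order and sign-reversing functions. -/

/-- A permutation has odd order exactly if no nonzero function changes its sign along it. -/
theorem odd_orderOf_iff_forall_eq_zero {α : Type*} [Fintype α] (x : Perm α) :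
    Odd (orderOf x) ↔ ∀ φ : α → ℤ, (∀ s, φ (x s) = -φ s) → ∀ s, φ s = 0 := by
  classical
  constructor
  · intro ho φ hφ s
    have h : ∀ j : ℕ, φ ((x ^ j) s) = (-1) ^ j * φ s := by
      intro j
      induction j with
      | zero => simp
      | succ j ih => rw [pow_succ', Perm.mul_apply, hφ, ih]; ring
    have := h (orderOf x)
    rw [pow_orderOf_eq_one, ho.neg_one_pow, Perm.one_apply] at this
    omega
  · intro h
    have key : ∀ s, ∃ j : ℤ, Odd j ∧ (x ^ j) s = s := by
      intro s
      by_contra! hs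
      have hdis : ∀ i j : ℤ, (x ^ (2 * i)) s ≠ (x ^ (2 * j + 1)) s := by
        intro i j hij
        refine hs (2 * j + 1 - 2 * i) ⟨j - i, by ring⟩ ?_
        rw [sub_eq_neg_add, zpow_add, Perm.mul_apply, ← hij, ← Perm.mul_apply, ← zpow_add]
        simp
      have hsucc : ∀ (j : ℤ) t, (x ^ j) s = x t ↔ (x ^ (j - 1)) s = t := by
        intro j t
        rw [sub_eq_neg_add, zpow_add, Perm.mul_apply, zpow_neg_one, Perm.inv_eq_iff_eq]
      -- If no odd power fixes `s`, the signs 1 and -1 can alternate consistently along its orbit.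
      have h0 := h (fun t => if ∃ i : ℤ, (x ^ (2 * i)) s = t then 1 else
        if ∃ i : ℤ, (x ^ (2 * i + 1)) s = t then -1 else 0) ?_ s
      · rw [if_pos ⟨0, by simp⟩] at h0
        exact one_ne_zero h0
      · intro t
        have e1 : (∃ i : ℤ, (x ^ (2 * i)) s = x t) ↔ ∃ i : ℤ, (x ^ (2 * i + 1)) s = t := by
          constructor
          · rintro ⟨i, hi⟩
            exact ⟨i - 1, by rw [hsucc] at hi; rw [← hi]; congr 2; ring⟩
          · rintro ⟨i, hi⟩
            exact ⟨i + 1, by rw [hsucc, ← hi]; congr 2; ring⟩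
        have e2 : (∃ i : ℤ, (x ^ (2 * i + 1)) s = x t) ↔ ∃ i : ℤ, (x ^ (2 * i)) s = t := by
          simp only [hsucc, add_sub_cancel_right]
        have e3 : ¬ ((∃ i : ℤ, (x ^ (2 * i)) s = t) ∧ ∃ i : ℤ, (x ^ (2 * i + 1)) s = t) := by
          rintro ⟨⟨i, hi⟩, j, hj⟩
          exact hdis i j (hi.trans hj.symm)
        simp only [e1, e2]
        split_ifs <;> simp_all
    choose j hj hx using key
    have h1 : x ^ (∏ s, j s) = 1 := by
      refine Equiv.ext fun s => ?_
      rw [← Finset.mul_prod_erase _ _ (mem_univ s), zpow_mul]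
      exact Perm.zpow_apply_eq_self_of_apply_eq_self (hx s) _
    have h2 := orderOf_dvd_iff_zpow_eq_one.2 h1
    have h3 : Odd (∏ s, j s) := Finset.prod_induction _ Odd (fun _ _ => Odd.mul) odd_one
      fun s _ => hj s
    obtain ⟨c, hc⟩ := h2
    rw [hc, Int.odd_mul] at h3
    exact_mod_cast h3.1

theorem odd_orderOf_optionCongr {α : Type*} [Fintype α] (y : Perm α) :
    Odd (orderOf (optionCongr y : Perm (Option α))) ↔ Odd (orderOf y) := by
  rw [odd_orderOf_iff_forall_eq_zero, odd_orderOf_iff_forall_eq_zero]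
  constructor
  · intro h φ hφ s
    exact h (fun t => t.elim 0 φ) (by rintro (_ | t) <;> simp [hφ]) (some s)
  · intro h φ hφ s
    obtain _ | s := s
    · have := hφ none
      simp only [optionCongr_apply, Option.map_none] at this
      omega
    · exact h (fun t => φ (some t)) (fun t => hφ (some t)) s

/-! ### Counting permutations of odd order. -/

section Insertion

variable {α : Type*} [Fintype α] [DecidableEq α]

/-- Inserting two consecutive points in front of a point of a cycle preserves oddness of the
order. -/
theorem odd_orderOf_decomposeOption_symm_some (b : α) (y : Perm α) :
    Odd (orderOf (Perm.decomposeOption.symm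
      (some none, Perm.decomposeOption.symm (some b, y)))) ↔ Odd (orderOf y) := by
  set x := Perm.decomposeOption.symm (some none, Perm.decomposeOption.symm (some b, y)) with hx
  have h1 : x none = some none := by simp [hx]
  have h2 : x (some none) = some (some b) := by simp [hx, swap_apply_def]
  have h3 : ∀ s, x (some (some s)) = if y s = b then none else some (some (y s)) := by
    intro s
    by_cases h : y s = b <;> simp [hx, swap_apply_def, h]
  rw [odd_orderOf_iff_forall_eq_zero, odd_orderOf_iff_forall_eq_zero]
  constructor
  · intro h φ hφ s
    -- The new cycle runs through `none`, `some none`, `some (some b)`, which forces these two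
    -- values.
    refine h (fun t => t.elim (φ b) fun t => t.elim (-φ b) φ) ?_ (some (some s))
    rintro (_ | _ | t)
    · simp [h1]
    · simp [h2]
    · rw [h3]
      have := hφ t
      split_ifs with hb
      · simpa [hb] using this
      · simpa using this
  · intro h φ hφ
    have k1 := hφ none
    have k2 := hφ (some none)
    rw [h1] at k1
    rw [h2] at k2
    have h0 : ∀ s, φ (some (some s)) = 0 := by
      refine h (fun t => φ (some (some t))) fun s => ?_
      have k3 := hφ (some (some s))
      rw [h3] at k3
      split_ifs at k3 with hb
      · rw [hb]; omega
      · exact k3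
    have := h0 b
    rintro (_ | _ | t)
    · omega
    · omega
    · exact h0 t

/-- Here `none` and `some none` form a 2-cycle. -/
theorem not_odd_orderOf_decomposeOption_symm_none (y : Perm α) :
    ¬ Odd (orderOf (Perm.decomposeOption.symm
      (some none, Perm.decomposeOption.symm (none, y)))) := by
  rw [odd_orderOf_iff_forall_eq_zero]
  intro h
  have := h (fun t => t.elim 1 fun t => t.elim (-1) fun _ => 0) ?_ none
  · simp at this
  · rintro (_ | _ | t) <;> simp [swap_apply_def]

theorem card_filter_odd_orderOf_apply_none :
    #{x : Perm (Option α) | Odd (orderOf x) ∧ x none = none} =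
      #{y : Perm α | Odd (orderOf y)} := by
  symm
  refine card_bij (fun y _ => optionCongr y) ?_ (fun _ _ _ _ h => optionCongr_injective h) ?_
  · intro y hy
    simpa [odd_orderOf_optionCongr] using hy
  · intro x hx
    simp only [mem_filter, mem_univ, true_and] at hx
    have h := map_equiv_removeNone x
    rw [hx.2, swap_self] at h
    have h' : optionCongr (removeNone x) = x := h
    refine ⟨removeNone x, ?_, h'⟩
    rw [mem_filter, ← odd_orderOf_optionCongr, h']
    exact ⟨mem_univ _, hx.1⟩

/-- Odd order excludes a 2-cycle, so some `b` in `α` follows `some none`; the factor counts the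
choices of `b`. -/
theorem card_filter_odd_orderOf_apply_some_none :
    #{x : Perm (Option (Option α)) | Odd (orderOf x) ∧ x none = some none} =
      Fintype.card α * #{y : Perm α | Odd (orderOf y)} := by
  rw [← card_univ, ← card_product]
  symm
  refine card_bij (fun p _ => Perm.decomposeOption.symm
      (some none, Perm.decomposeOption.symm (some p.1, p.2))) ?_ ?_ ?_
  · rintro ⟨b, y⟩ h
    simp only [mem_product, mem_filter, mem_univ, true_and] at h ⊢
    exact ⟨(odd_orderOf_decomposeOption_symm_some b y).2 h, by simp⟩
  · rintro ⟨b, y⟩ - ⟨b', y'⟩ - h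
    have h1 := Perm.decomposeOption.symm.injective h
    rw [Prod.mk.injEq, Perm.decomposeOption.symm.injective.eq_iff] at h1
    simpa using h1
  · intro x hx
    simp only [mem_filter, mem_univ, true_and] at hx
    obtain ⟨⟨i, z⟩, rfl⟩ := Perm.decomposeOption.symm.surjective x
    obtain ⟨⟨j, y⟩, rfl⟩ := Perm.decomposeOption.symm.surjective z
    obtain rfl : i = some none := by simpa using hx.2
    obtain _ | b := j
    · exact absurd hx.1 (not_odd_orderOf_decomposeOption_symm_none y)
    · refine ⟨(b, y), ?_, rfl⟩
      simpa using (odd_orderOf_decomposeOption_symm_some b y).1 hx.1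

theorem orderOf_conj {G : Type*} [Group G] (a x : G) : orderOf (a * x * a⁻¹) = orderOf x :=
  (MulAut.conj a).orderOf_eq x

theorem card_filter_odd_orderOf_apply_eq {p i j : α} (hi : i ≠ p) (hj : j ≠ p) :
    #{x : Perm α | Odd (orderOf x) ∧ x p = i} = #{x : Perm α | Odd (orderOf x) ∧ x p = j} := by
  refine card_equiv (MulAut.conj (swap i j)).toEquiv fun x => ?_
  have h := orderOf_conj (swap i j) x
  rw [swap_inv] at h
  simp [swap_apply_of_ne_of_ne hi.symm hj.symm, swap_apply_eq_iff, h]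

theorem card_filter_odd_orderOf_congr {β : Type*} [Fintype β] [DecidableEq β] (e : α ≃ β) :
    #{x : Perm α | Odd (orderOf x)} = #{x : Perm β | Odd (orderOf x)} :=
  card_equiv e.permCongrHom.toEquiv fun x => by
    simp [show orderOf (e.permCongr x) = orderOf x from e.permCongrHom.orderOf_eq x]

end Insertion

/-- The number of elements of odd order of the symmetric group `S_m`. -/
noncomputable def oddOrderCount (m : ℕ) : ℕ := #{x : Perm (Fin m) | Odd (orderOf x)}

theorem card_filter_odd_orderOf (α : Type*) [Fintype α] [DecidableEq α] :
    #{x : Perm α | Odd (orderOf x)} = oddOrderCount (Fintype.card α) :=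
  card_filter_odd_orderOf_congr (Fintype.equivFin α)

/-- Sort by the image of one point: either it is fixed, or it has one of `m + 1` other images, all
equally frequent by conjugation. -/
theorem oddOrderCount_add_two (m : ℕ) :
    oddOrderCount (m + 2) = oddOrderCount (m + 1) + (m + 1) * (m * oddOrderCount m) := by
  have h : oddOrderCount (m + 2) = #{x : Perm (Option (Option (Fin m))) | Odd (orderOf x)} := by
    rw [card_filter_odd_orderOf]; simp
  rw [h, card_eq_sum_card_fiberwise (f := fun x => x none) (t := univ) (by simp),
    Fintype.sum_option]
  simp only [filter_filter]
  rw [card_filter_odd_orderOf_apply_none, card_filter_odd_orderOf, Fintype.card_option,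
    Fintype.card_fin, sum_congr rfl fun i _ =>
      card_filter_odd_orderOf_apply_eq (Option.some_ne_none i) (Option.some_ne_none none),
    card_filter_odd_orderOf_apply_some_none, sum_const, card_univ]
  simp [oddOrderCount]

theorem oddOrderCount_two_mul (m : ℕ) :
    oddOrderCount (2 * m + 1) = (2 * m + 1) * oddOrderCount (2 * m) := by
  induction m with
  | zero => simp [oddOrderCount, Subsingleton.elim _ (1 : Perm (Fin _))]
  | succ m ih =>
    have h1 := oddOrderCount_add_two (2 * m)
    have h2 := oddOrderCount_add_two (2 * m + 1)
    have e : 2 * (m + 1) = 2 * m + 2 := by ring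
    rw [e, show 2 * m + 2 + 1 = 2 * m + 1 + 2 by ring, h2]
    -- The even-degree companion identity; each of the two yields the next through the recurrence.
    have h3 : oddOrderCount (2 * m + 1 + 1) = (2 * m + 1) * oddOrderCount (2 * m + 1) := by
      change oddOrderCount (2 * m + 2) = _
      rw [h1, ih]; ring
    change oddOrderCount (2 * m + 1 + 1) + _ = _ * oddOrderCount (2 * m + 1 + 1)
    rw [h3]; ring

theorem card_filter_odd_orderOf_apply_eq_self {α : Type*} [Fintype α] [DecidableEq α] (i : α) :
    #{x : Perm α | Odd (orderOf x) ∧ x i = i} = oddOrderCount (Fintype.card α - 1) := by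
  let e : Option {a // a ≠ i} ≃ α := optionSubtypeNe i
  have h : #{x : Perm α | Odd (orderOf x) ∧ x i = i} =
      #{x : Perm (Option {a // a ≠ i}) | Odd (orderOf x) ∧ x none = none} := by
    refine card_equiv e.symm.permCongrHom.toEquiv fun x => ?_
    have he : e none = i := by simp [e]
    have ho : orderOf (e.symm.permCongr x) = orderOf x := e.symm.permCongrHom.orderOf_eq x
    simp [ho, he, e.symm_apply_eq]
  rw [h, card_filter_odd_orderOf_apply_none, card_filter_odd_orderOf]
  simp

/-- On a set with an odd number of points, the permutations of odd order have one fixed point on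
average. -/
theorem sum_card_fixed_odd_orderOf {α : Type*} [Fintype α] [DecidableEq α]
    (hα : Odd (Fintype.card α)) :
    ∑ x : Perm α with Odd (orderOf x), #{i | x i = i} = #{x : Perm α | Odd (orderOf x)} := by
  have h := sum_card_bipartiteAbove_eq_sum_card_bipartiteBelow
    (s := {x : Perm α | Odd (orderOf x)}) (t := univ) fun x i => x i = i
  simp only [bipartiteAbove, bipartiteBelow, filter_filter, card_filter_odd_orderOf_apply_eq_self] at h
  obtain ⟨m, hm⟩ := hα
  rw [h, card_filter_odd_orderOf, sum_const, card_univ, hm, oddOrderCount_two_mul]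
  simp

/-! ### Odd roots of a given permutation. -/

theorem zpow_oddLcm_eq_one_iff {m : ℕ} (x : Perm (Fin m)) :
    x ^ (oddLcm m : ℤ) = 1 ↔ Odd (orderOf x) := by
  rw [zpow_natCast, ← orderOf_dvd_iff_pow_eq_one]
  refine ⟨fun h => (odd_oddLcm m).of_dvd_nat h, fun h => ?_⟩
  exact (h.coprime_two_right.pow_right m).dvd_of_dvd_mul_left (orderOf_dvd_oddLcm x)

/-- The number of fixed points of a permutation with an odd root of maximal level has the parity
of the number of all points. -/
theorem card_fixed_modEq_of_zpow_oddLcm_eq {m : ℕ} {g x : Perm (Fin m)}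
    (hx : x ^ (oddLcm m : ℤ) = g) : m ≡ Fintype.card {a // g a = a} [MOD 2] := by
  -- The odd part of the order of `x` is killed by the exponent, so the nontrivial cycles of `g`
  -- have even length.
  have h1 : g ^ 2 ^ m = 1 := by
    rw [← hx, zpow_natCast, ← pow_mul, mul_comm]
    exact orderOf_dvd_iff_pow_eq_one.1 (orderOf_dvd_oddLcm x)
  have h2 : (MulAction.toEndHom g : Function.End (Fin m)) ^ 2 ^ m = 1 :=
    (map_pow (MulAction.toEndHom (M := Perm (Fin m)) (α := Fin m)) g (2 ^ m)).symm.trans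
      (by rw [h1, map_one])
  have h3 := Perm.card_fixedPoints_modEq h2
  rw [Fintype.card_fin] at h3
  convert h3
  exact Iff.rfl

theorem filter_zpow_oddLcm_eq {m : ℕ} (g : Perm (Fin m)) :
    ({x : Perm (Fin m) | x ^ (oddLcm m : ℤ) = g} : Finset _) =
      (({u : Perm {a // g a = a} | Odd (orderOf u)} : Finset _) ×ˢ
        ({v : Perm {a // ¬ g a = a} | v ^ (oddLcm m : ℤ) =
          g.subtypePerm fun a => by simp} : Finset _)).map
        ⟨Perm.subtypeCongrHom fun a => g a = a, Perm.subtypeCongrHom_injective _⟩ := by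
  have hg : g = Perm.subtypeCongrHom (fun a => g a = a) (1, g.subtypePerm fun a => by simp) := by
    ext a
    by_cases h : g a = a <;> simp [Perm.subtypeCongrHom, h]
  -- The exponent belongs to degree `m`, so `u` is first extended by the identity to all `m` points.
  have hu : ∀ u : Perm {a // g a = a}, Odd (orderOf u) ↔ u ^ (oddLcm m : ℤ) = 1 := by
    intro u
    rw [← orderOf_injective _ Perm.ofSubtype_injective u, ← zpow_oddLcm_eq_one_iff, ← map_zpow,
      map_eq_one_iff _ Perm.ofSubtype_injective]
  have hroot : ∀ u v, Perm.subtypeCongrHom (fun a => g a = a) (u, v) ^ (oddLcm m : ℤ) = g ↔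
      Odd (orderOf u) ∧ v ^ (oddLcm m : ℤ) = g.subtypePerm fun a => by simp := by
    intro u v
    conv_lhs => rhs; rw [hg]
    rw [← map_zpow, (Perm.subtypeCongrHom_injective _).eq_iff, hu, Prod.pow_mk, Prod.mk.injEq]
  ext x
  simp only [mem_filter, mem_univ, true_and, mem_map, mem_product, Function.Embedding.coeFn_mk,
    Prod.exists]
  constructor
  · intro hx
    have hc : ∀ a, g (x a) = x (g a) := fun a => by
      rw [← hx, ← Perm.mul_apply, ← Perm.mul_apply, (Commute.refl x).zpow_left _ |>.eq]
    have hp : ∀ a, g (x a) = x a ↔ g a = a := fun a => by rw [hc, x.injective.eq_iff]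
    have he : Perm.subtypeCongrHom (fun a => g a = a)
        (x.subtypePerm hp, x.subtypePerm fun a => (hp a).not) = x := by
      ext a
      by_cases h : g a = a <;> simp [Perm.subtypeCongrHom, h]
    exact ⟨_, _, (hroot _ _).1 (by rw [he, hx]), he⟩
  · rintro ⟨u, v, huv, rfl⟩
    exact (hroot u v).2 huv

/-- In a symmetric group of odd degree, the odd roots of an element have one fixed point on
average. -/
theorem sum_card_fixed_zpow_oddLcm_eq {m : ℕ} (hm : Odd m) (g : Perm (Fin m)) :
    ∑ x : Perm (Fin m) with x ^ (oddLcm m : ℤ) = g, #{i | x i = i} =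
      #{x : Perm (Fin m) | x ^ (oddLcm m : ℤ) = g} := by
  obtain h0 | ⟨x, hx⟩ := eq_empty_or_nonempty ({x : Perm (Fin m) | x ^ (oddLcm m : ℤ) = g} : Finset _)
  · rw [h0]; simp
  have hF : Odd (Fintype.card {a // g a = a}) := by
    have := card_fixed_modEq_of_zpow_oddLcm_eq (mem_filter.1 hx).2
    rw [Nat.odd_iff] at hm ⊢
    rwa [← this]
  rw [filter_zpow_oddLcm_eq, sum_map, card_map, card_product, ← sum_card_fixed_odd_orderOf hF,
    sum_product, sum_mul]
  refine sum_congr rfl fun u _ => ?_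
  rw [mul_comm, ← smul_eq_mul, ← sum_const]
  refine sum_congr rfl fun v hv => ?_
  symm
  refine card_bij (fun i _ => i.1) ?_ (fun _ _ _ _ h => Subtype.ext h) ?_
  · intro i hi
    simp only [mem_filter, mem_univ, true_and] at hi
    simp [Perm.subtypeCongrHom, Perm.subtypeCongr.apply, i.2, hi]
  · intro a ha
    simp only [mem_filter, mem_univ, true_and, Function.Embedding.coeFn_mk] at ha hv
    by_cases h : g a = a
    · refine ⟨⟨a, h⟩, ?_, rfl⟩
      simpa [Perm.subtypeCongrHom, Perm.subtypeCongr.apply, h, Subtype.ext_iff] using ha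
    · have hva : v ⟨a, h⟩ = ⟨a, h⟩ := by
        simpa [Perm.subtypeCongrHom, Perm.subtypeCongr.apply, h, Subtype.ext_iff] using ha
      -- A fixed point of `v` would be fixed by its power, the restriction of `g` to moved points.
      have := Perm.zpow_apply_eq_self_of_apply_eq_self hva (oddLcm m)
      rw [hv] at this
      exact absurd (congrArg Subtype.val this) h

/-! ### Induction as a count of fixed points. -/

/-- Averaging over the images of a point under all permutations is averaging over all points. -/
theorem sum_perm_apply {n : ℕ} (F : Fin (n + 1) → ℕ) (p : Fin (n + 1)) :
    ∑ a : Perm (Fin (n + 1)), F (a p) = n.factorial * ∑ i, F i := by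
  have h1 : ∀ j, ∑ a : Perm (Fin (n + 1)), F (a j) = ∑ a : Perm (Fin (n + 1)), F (a p) :=
    fun j => Fintype.sum_equiv (Equiv.mulRight (swap p j)) _ _ fun a => by simp
  have h2 : ∑ j, ∑ a : Perm (Fin (n + 1)), F (a j) = (n + 1).factorial * ∑ i, F i := by
    rw [sum_comm, sum_congr rfl fun a _ => Equiv.sum_comp a F]
    simp [Fintype.card_perm]
  rw [sum_congr rfl fun j _ => h1 j, sum_const, card_univ, Fintype.card_fin, smul_eq_mul,
    Nat.factorial_succ, mul_assoc] at h2
  exact Nat.eq_of_mul_eq_mul_left n.succ_pos h2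

theorem symmEmbedding_injective (n : ℕ) : Function.Injective (symmEmbedding n) :=
  Perm.viaEmbeddingHom_injective _

theorem exists_symmEmbedding_eq {n : ℕ} {y : Perm (Fin (n + 1))} (hy : y (Fin.last n) = Fin.last n) :
    ∃ x, symmEmbedding n x = y := by
  have hp : ∀ a, y a ≠ Fin.last n ↔ a ≠ Fin.last n := fun a => by
    conv_lhs => rw [← hy]
    exact y.injective.ne_iff
  let e : {a // a ≠ Fin.last n} ≃ Fin n := (finSuccAboveEquiv (Fin.last n)).symm
  have he : ∀ i, (e.symm i : Fin (n + 1)) = i.castSucc := fun i => by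
    simp [e, finSuccAboveEquiv_apply]
  refine ⟨e.permCongr (y.subtypePerm hp), Equiv.ext fun a => ?_⟩
  induction a using Fin.lastCases with
  | last => rw [symmEmbedding_last, hy]
  | cast i =>
    rw [symmEmbedding_castSucc, ← he, permCongr_apply, symm_apply_apply, Perm.subtypePerm_apply]
    simp [he]

/-- Conjugation by `a` carries the stabilizer of the last point to the stabilizer of its image under
`a`. -/
theorem sum_rootEnumerator_symmEmbedding (k : ℤ) (n : ℕ) (a g : Perm (Fin (n + 1))) :
    ∑ h, (if symmEmbedding n h = a⁻¹ * g * a then rootEnumerator k n h else 0) =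
      #{y : Perm (Fin (n + 1)) | y ^ k = g ∧ y (a (Fin.last n)) = a (Fin.last n)} := by
  have h1 : ∑ h, (if symmEmbedding n h = a⁻¹ * g * a then rootEnumerator k n h else 0) =
      #{x : Perm (Fin n) | symmEmbedding n (x ^ k) = a⁻¹ * g * a} := by
    rw [card_eq_sum_card_fiberwise (f := fun x => x ^ k) (t := univ) (by simp)]
    refine sum_congr rfl fun h _ => ?_
    rw [filter_filter]
    split_ifs with hh
    · exact congrArg card (filter_congr fun x _ => ⟨fun e => ⟨by rw [e, hh], e⟩, fun e => e.2⟩)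
    · rw [eq_comm, card_eq_zero, filter_eq_empty_iff]
      rintro x - ⟨e, rfl⟩
      exact hh e
  have hconj : ∀ z, z ^ k = a⁻¹ * g * a ↔ (a * z * a⁻¹) ^ k = g := fun z => by
    rw [conj_zpow]
    constructor
    · intro h; rw [h]; group
    · rintro rfl; group
  rw [h1]
  refine card_bij (fun x _ => a * symmEmbedding n x * a⁻¹) ?_ ?_ ?_
  · intro x hx
    simp only [mem_filter, mem_univ, true_and] at hx ⊢
    rw [map_zpow, hconj] at hx
    exact ⟨hx, by simp [symmEmbedding_last]⟩
  · intro x _ x' _ h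
    exact symmEmbedding_injective n (by simpa using h)
  · intro y hy
    simp only [mem_filter, mem_univ, true_and] at hy
    obtain ⟨x, hx⟩ := exists_symmEmbedding_eq (y := a⁻¹ * y * a) (by simp [hy.2])
    have hxy : a * symmEmbedding n x * a⁻¹ = y := by rw [hx]; group
    refine ⟨x, ?_, hxy⟩
    simp only [mem_filter, mem_univ, true_and]
    rw [map_zpow, hconj, hxy, hy.1]

/-- The class function induced from the root enumerator of `S_n` counts the roots in `S_{n+1}`,
each with its number of fixed points as multiplicity. -/
theorem inducedClassFunction_rootEnumerator (k : ℤ) (n : ℕ) (g : Perm (Fin (n + 1))) :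
    inducedClassFunction (symmEmbedding n) (fun h => (rootEnumerator k n h : ℂ)) g =
      ((∑ x : Perm (Fin (n + 1)) with x ^ k = g, #{i | x i = i} : ℕ) : ℂ) := by
  have h := sum_card_bipartiteAbove_eq_sum_card_bipartiteBelow
    (s := {x : Perm (Fin (n + 1)) | x ^ k = g}) (t := univ) fun x i => x i = i
  simp only [bipartiteAbove, bipartiteBelow, filter_filter] at h
  have h2 := sum_perm_apply
    (fun i => #{x : Perm (Fin (n + 1)) | x ^ k = g ∧ x i = i}) (Fin.last n)
  rw [← h] at h2
  simp only [← sum_rootEnumerator_symmEmbedding] at h2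
  have h3 := congrArg (Nat.cast : ℕ → ℂ) h2
  rw [inducedClassFunction, Fintype.card_perm, Fintype.card_fin,
    inv_mul_eq_iff_eq_mul₀ (by exact_mod_cast n.factorial_ne_zero)]
  push_cast at h3 ⊢
  exact h3

theorem oddLcm_dvd_oddLcm {m n : ℕ} (h : m ≤ n) : oddLcm m ∣ oddLcm n := by
  refine Finset.lcm_dvd fun i hi => ?_
  have := Finset.mem_Icc.1 hi
  exact dvd_oddLcm ⟨i - 1, by omega⟩ (by omega)

theorem proposition6p3 (n : ℕ) (hn : 0 < n) (g : Equiv.Perm (Fin (2 * n + 1))) :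
    (oddRootEnumerator (2 * n + 1) g : ℂ) =
      inducedClassFunction (symmEmbedding (2 * n))
        (fun h => (oddRootEnumerator (2 * n) h : ℂ)) g := by
  -- Both sides must use the same exponent; that of degree `2 * n + 1` also serves in degree `2 *
  -- n`.
  have h : ∀ h : Perm (Fin (2 * n)),
      oddRootEnumerator (2 * n) h = rootEnumerator (oddLcm (2 * n + 1)) (2 * n) h := fun h =>
    (rootEnumerator_eq_oddRootEnumerator (by exact_mod_cast odd_oddLcm (2 * n + 1))
      (by exact_mod_cast oddLcm_dvd_oddLcm (Nat.le_succ _)) h).symm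
  simp only [h]
  rw [inducedClassFunction_rootEnumerator, sum_card_fixed_zpow_oddLcm_eq ⟨n, rfl⟩]
  rfl
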